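/- Let $p$ be a prime and let $G$ be a finite non-cyclic $p$-group, with identity element $1$. Then $G$ has a cyclic subgroup of index $p$ if and only if $$\mathsf d(G)+1=\mathsf D_o(G)=\mathsf L(G)=\frac{|G|}{p}+p-1 .$$ Here: - $\mathsf d(G)$, the small Davenport constant, is the largest length of a finite unordered sequence (multiset) $S$ over $G$ such that no non-empty subsequence of $S$ has a product, its terms being multiplied in some order, equal to $1$; - $\mathsf D_o(G)$, the ordered Davenport constant, is the least $k\in\mathbb N$ such that every finite ordered sequence $(g_1,\dots,g_\ell)$ over $G$ of length $\ell\ge k$ satisfies $g_{i_1}g_{i_2}\cdots g_{i_m}=1$ for some $m\ge 1$ and some $1\le i_1<i_2<\dots<i_m\le \ell$; - $\mathsf L(G)$, the Loewy length, is the nilpotency index of the Jacobson radical $J$ of the group algebra $\mathbb F_p[G]$, that is, the least $n$ with $J^n=0$. -/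

import Mathlib

/-- `π(S)`: all products of the terms of the (unordered) sequence `S` over `G`, taken in any order.
A sequence over `G` is a finite multiset of elements of `G`. -/
def seqProducts {G : Type*} [Group G] (S : Multiset G) : Set G :=
  {g | ∃ l : List G, (l : Multiset G) = S ∧ l.prod = g}

/-- `Π(S)`: the union of `π(T)` over all subsequences `T` of `S` of length at least one. -/
def seqSubproducts {G : Type*} [Group G] (S : Multiset G) : Set G :=
  {g | ∃ T : Multiset G, T ≤ S ∧ 1 ≤ T.card ∧ g ∈ seqProducts T}

/-- The small Davenport constant `d(G)`: the supremum of the lengths of the sequences `S` over `G`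
with `1 ∉ Π(S)`. -/
noncomputable def smallDavenport (G : Type*) [Group G] : ℕ :=
  sSup {n : ℕ | ∃ S : Multiset G, S.card = n ∧ (1 : G) ∉ seqSubproducts S}

/-- `Π(S*)` for an ordered sequence `S*`, that is, a list: the products, in the given order, of all
ordered subsequences (sublists) of length at least one. -/
def orderedSubproducts {G : Type*} [Group G] (S : List G) : Set G :=
  {g | ∃ T : List G, T.Sublist S ∧ 1 ≤ T.length ∧ T.prod = g}

/-- The ordered Davenport constant `D_o(G)`: the least `k` such that every ordered sequence `S*`
over `G` of length at least `k` satisfies `1 ∈ Π(S*)`. -/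
noncomputable def orderedDavenport (G : Type*) [Group G] : ℕ :=
  sInf {k : ℕ | ∀ S : List G, k ≤ S.length → (1 : G) ∈ orderedSubproducts S}

/-- The Loewy length `L(G)` of the group algebra `𝔽_p[G]`: the nilpotency index of its Jacobson
radical `J`, that is, the least `n` with `J ^ n = 0`. -/
noncomputable def loewyLength (p : ℕ) (G : Type*) [Group G] : ℕ :=
  nilpotencyClass (Ring.jacobson (MonoidAlgebra (ZMod p) G))

/-- In a finite group, every ordered sequence of length at least `|G|` has a nonempty ordered
subsequence with product one, so that `orderedDavenport` is an attained minimum. -/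
theorem one_mem_orderedSubproducts {G : Type*} [Group G] [Finite G] (S : List G)
    (hS : Nat.card G ≤ S.length) : (1 : G) ∈ orderedSubproducts S := by
  have := Fintype.ofFinite G
  rw [Nat.card_eq_fintype_card] at hS
  obtain ⟨i, j, hij, h⟩ := Fintype.exists_ne_map_eq_of_card_lt
    (fun i : Fin (S.length + 1) => (S.take i).prod) (by simpa using Nat.lt_succ_of_le hS)
  wlog hlt : i < j generalizing i j
  · exact this j i hij.symm h.symm (lt_of_le_of_ne (not_lt.mp hlt) hij.symm)
  have hlt' : (i : ℕ) < j := hlt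
  refine ⟨(S.take j).drop i, (List.drop_sublist _ _).trans (List.take_sublist _ _), ?_, ?_⟩
  · have := j.2
    simp only [List.length_drop, List.length_take]
    omega
  · have h1 := List.prod_take_mul_prod_drop (S.take j) i
    rw [List.take_take, min_eq_left hlt'.le] at h1
    rw [← h] at h1
    simpa using h1

/-- For a finite group, the lengths in the definition of `smallDavenport` are bounded. -/
theorem bddAbove_smallDavenport {G : Type*} [Group G] [Finite G] :
    BddAbove {n : ℕ | ∃ S : Multiset G, S.card = n ∧ (1 : G) ∉ seqSubproducts S} := by
  refine ⟨Nat.card G, ?_⟩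
  rintro n ⟨S, rfl, h⟩
  by_contra! hlt
  induction S using Quotient.inductionOn with
  | h l =>
    obtain ⟨T, hT, hlen, hprod⟩ := one_mem_orderedSubproducts l (by simpa using hlt.le)
    exact h ⟨T, Multiset.coe_le.mpr hT.subperm, by simpa using hlen, T, rfl, hprod⟩

/-! The pivot is `AugmentationVanishes p G k`: the augmentation ideal of 𝔽_p[G] has `k`-th power
zero. For a finite p-group this ideal is the Jacobson radical, so the least such `k` is L(G)
(`loewyLength_le`, `augmentationVanishes_loewyLength`). Expanding a product of factors `g - 1` and
reading the coefficient at 1 gives D_o ≤ L (`orderedDavenport_le`), and d < D_o is immediate.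

If ⟨a⟩ has index p and g lies outside it, the sequence of |a| - 1 copies of a and p - 1 copies of g
bounds d from below, and a filtration by weighted monomials (`augmentationVanishes_of_generators`)
bounds L above by |a| + p - 1; the chain d + 1 ≤ D_o ≤ L closes up.

Conversely, a noncyclic group of order p^n with no cyclic subgroup of index p has L ≤ p^(n-1), too
small by p - 1. This goes by induction through the quotient Q by a central z of order p. If Q
satisfies its bound, that bound lifts with a factor p because (z - 1)^p = 0. If Q has a cyclic
subgroup of index p, then G is generated by a, z, g with explicit relations, and the filtration with
a suitable weight for z suffices, as all elements of G have small order. -/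

/-! ### Weighted filtrations of a ring -/

section Filtration

variable {R : Type*} [Ring R]

/-- The additive subgroup generated by the monomials `α ^ i * ζ ^ m` of weight at least `w`, where
`α` has weight `1` and `ζ` has weight `c`. -/
def monomialSpan (α ζ : R) (c w : ℕ) : AddSubgroup R :=
  AddSubgroup.closure {x | ∃ i m : ℕ, w ≤ i + c * m ∧ x = α ^ i * ζ ^ m}

/-- The filtration of `R` generated by a filtration `I` and powers `y ^ j` with `j < p`, where `y`
has weight `1`. -/
def extendedSpan (I : ℕ → AddSubgroup R) (y : R) (p w : ℕ) : AddSubgroup R :=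
  AddSubgroup.closure {x | ∃ i j : ℕ, ∃ r ∈ I i, j < p ∧ w ≤ i + j ∧ x = r * y ^ j}

theorem monomialSpan_antitone (α ζ : R) (c : ℕ) : Antitone (monomialSpan α ζ c) := by
  intro v w hvw
  refine AddSubgroup.closure_mono ?_
  rintro x ⟨i, m, h, rfl⟩
  exact ⟨i, m, hvw.trans h, rfl⟩

theorem monomial_mem_monomialSpan (α ζ : R) {c w i m : ℕ} (h : w ≤ i + c * m) :
    α ^ i * ζ ^ m ∈ monomialSpan α ζ c w :=
  AddSubgroup.subset_closure ⟨i, m, h, rfl⟩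

theorem one_mem_monomialSpan (α ζ : R) (c : ℕ) : (1 : R) ∈ monomialSpan α ζ c 0 := by
  simpa using monomial_mem_monomialSpan α ζ (c := c) (w := 0) (i := 0) (m := 0) (by simp)

theorem left_mem_monomialSpan (α ζ : R) (c : ℕ) : α ∈ monomialSpan α ζ c 1 := by
  simpa using monomial_mem_monomialSpan α ζ (c := c) (w := 1) (i := 1) (m := 0) (by simp)

theorem right_mem_monomialSpan (α ζ : R) (c : ℕ) : ζ ∈ monomialSpan α ζ c c := by
  simpa using monomial_mem_monomialSpan α ζ (c := c) (w := c) (i := 0) (m := 1) (by simp)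

theorem mul_mem_monomialSpan {α ζ : R} (hc : Commute α ζ) {c v w : ℕ} {x y : R}
    (hx : x ∈ monomialSpan α ζ c v) (hy : y ∈ monomialSpan α ζ c w) :
    x * y ∈ monomialSpan α ζ c (v + w) := by
  induction hx using AddSubgroup.closure_induction with
  | zero => simp
  | add a b _ _ ha hb => rw [add_mul]; exact add_mem ha hb
  | neg a _ ha => rw [neg_mul]; exact neg_mem ha
  | mem a ha =>
    obtain ⟨i, m, h, rfl⟩ := ha
    induction hy using AddSubgroup.closure_induction with
    | zero => simp
    | add a b _ _ ha hb => rw [mul_add]; exact add_mem ha hb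
    | neg a _ ha => rw [mul_neg]; exact neg_mem ha
    | mem b hb =>
      obtain ⟨j, n, h', rfl⟩ := hb
      have e : α ^ i * ζ ^ m * (α ^ j * ζ ^ n) = α ^ (i + j) * ζ ^ (m + n) := by
        rw [mul_assoc, ← mul_assoc (ζ ^ m), ← (hc.pow_pow j m).eq, pow_add, pow_add]
        simp only [mul_assoc]
      rw [e]
      exact monomial_mem_monomialSpan α ζ (by rw [mul_add]; omega)

theorem pow_mem_monomialSpan {α ζ : R} (hc : Commute α ζ) {c v : ℕ} {x : R}
    (hx : x ∈ monomialSpan α ζ c v) (n : ℕ) : x ^ n ∈ monomialSpan α ζ c (v * n) := by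
  induction n with
  | zero => simpa using one_mem_monomialSpan α ζ c
  | succ n ih => rw [pow_succ, mul_add, mul_one]; exact mul_mem_monomialSpan hc ih hx

/-- A nonzero monomial has `i ≤ N - 1` and `m ≤ M - 1`, hence weight at most `N - 1 + c * (M - 1)`.
-/
theorem monomialSpan_eq_bot {α ζ : R} {N M c w : ℕ} (hα : α ^ N = 0) (hζ : ζ ^ M = 0)
    (hw : N + c * (M - 1) ≤ w) : monomialSpan α ζ c w = ⊥ := by
  rw [monomialSpan, AddSubgroup.closure_eq_bot_iff]
  rintro x ⟨i, m, h, rfl⟩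
  rw [Set.mem_singleton_iff]
  by_cases hi : N ≤ i
  · rw [pow_eq_zero_of_le hi hα, zero_mul]
  by_cases hm : M ≤ m
  · rw [pow_eq_zero_of_le hm hζ, mul_zero]
  · have : c * m ≤ c * (M - 1) := Nat.mul_le_mul_left _ (by omega)
    omega

/-- If `y` commutes with `ζ`, and commutes with `α` up to terms of higher weight, then it does so
with all elements of the filtration `monomialSpan`. -/
theorem exists_mul_eq_of_mem_monomialSpan {α ζ y d : R} {c : ℕ} (hc : Commute α ζ)
    (hyζ : Commute y ζ) (hd : d ∈ monomialSpan α ζ c 2) (hyα : y * α = (α + d) * y + d)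
    {w : ℕ} {x : R} (hx : x ∈ monomialSpan α ζ c w) :
    ∃ e ∈ monomialSpan α ζ c (w + 1), y * x = (x + e) * y + e := by
  have hpow (i : ℕ) : ∃ e ∈ monomialSpan α ζ c (i + 1), y * α ^ i = (α ^ i + e) * y + e := by
    induction i with
    | zero => exact ⟨0, zero_mem _, by simp⟩
    | succ i ih =>
      obtain ⟨e, he, h⟩ := ih
      refine ⟨α ^ i * d + e * α + e * d, add_mem (add_mem ?_ ?_) ?_, ?_⟩
      · have := pow_mem_monomialSpan hc (left_mem_monomialSpan α ζ c) i
        exact monomialSpan_antitone α ζ c (by omega) (mul_mem_monomialSpan hc this hd)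
      · exact mul_mem_monomialSpan hc he (left_mem_monomialSpan α ζ c)
      · exact monomialSpan_antitone α ζ c (by omega) (mul_mem_monomialSpan hc he hd)
      · rw [pow_succ, ← mul_assoc, h, add_mul, mul_assoc _ y, hyα]
        noncomm_ring
  induction hx using AddSubgroup.closure_induction with
  | zero => exact ⟨0, zero_mem _, by simp⟩
  | add a b _ _ ha hb =>
    obtain ⟨e, he, h⟩ := ha
    obtain ⟨e', he', h'⟩ := hb
    exact ⟨e + e', add_mem he he', by rw [mul_add, h, h']; noncomm_ring⟩
  | neg a _ ha =>
    obtain ⟨e, he, h⟩ := ha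
    exact ⟨-e, neg_mem he, by rw [mul_neg, h]; noncomm_ring⟩
  | mem a ha =>
    obtain ⟨i, m, hw, rfl⟩ := ha
    obtain ⟨e, he, h⟩ := hpow i
    refine ⟨e * ζ ^ m, ?_, ?_⟩
    · have := mul_mem_monomialSpan hc he
        (pow_mem_monomialSpan hc (right_mem_monomialSpan α ζ c) m)
      exact monomialSpan_antitone α ζ c (by omega) this
    · rw [← mul_assoc, h, add_mul, mul_assoc _ y, (hyζ.pow_right m).eq]
      noncomm_ring

variable {I : ℕ → AddSubgroup R} {y : R} {p : ℕ}

theorem extendedSpan_antitone : Antitone (extendedSpan I y p) := by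
  intro v w hvw
  refine AddSubgroup.closure_mono ?_
  rintro x ⟨i, j, r, hr, hj, h, rfl⟩
  exact ⟨i, j, r, hr, hj, hvw.trans h, rfl⟩

theorem extendedSpan_eq_bot {m w : ℕ} (hI : ∀ i, m ≤ i → I i = ⊥) (hw : m + p - 1 ≤ w) :
    extendedSpan I y p w = ⊥ := by
  rw [extendedSpan, AddSubgroup.closure_eq_bot_iff]
  rintro x ⟨i, j, r, hr, hj, h, rfl⟩
  rw [hI i (by omega), AddSubgroup.mem_bot] at hr
  simp [hr]

/-- When the exponent of `y` reaches `p`, hypothesis `hp` absorbs `y ^ p` into the coefficient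
without loss of weight. -/
theorem mul_generator_mem_extendedSpan
    (hp : ∀ i, ∀ x ∈ I i, x * y ^ p ∈ I (i + p)) (hp0 : 0 < p) {w : ℕ} {x : R}
    (hx : x ∈ extendedSpan I y p w) : x * y ∈ extendedSpan I y p (w + 1) := by
  induction hx using AddSubgroup.closure_induction with
  | zero => simp
  | add a b _ _ ha hb => rw [add_mul]; exact add_mem ha hb
  | neg a _ ha => rw [neg_mul]; exact neg_mem ha
  | mem a ha =>
    obtain ⟨i, j, r, hr, hj, h, rfl⟩ := ha
    rw [mul_assoc, ← pow_succ]
    refine AddSubgroup.subset_closure ?_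
    rcases Nat.lt_or_ge (j + 1) p with hlt | hge
    · exact ⟨i, j + 1, r, hr, hlt, by omega, rfl⟩
    · obtain rfl : p = j + 1 := by omega
      exact ⟨i + (j + 1), 0, r * y ^ (j + 1), hp i r hr, hp0, by omega, by simp⟩

/-- Move `s` left across `y ^ j` one factor at a time: a swap that loses its `y` leaves the error
`e`, whose weight is one more than that of `s`. -/
theorem mul_mem_extendedSpan (hI : Antitone I)
    (hmul : ∀ i j, ∀ x ∈ I i, ∀ x' ∈ I j, x * x' ∈ I (i + j))
    (hcomm : ∀ i, ∀ x ∈ I i, ∃ e ∈ I (i + 1), y * x = (x + e) * y + e)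
    (hp : ∀ i, ∀ x ∈ I i, x * y ^ p ∈ I (i + p)) (hp0 : 0 < p) {v w : ℕ} {x s : R}
    (hx : x ∈ extendedSpan I y p w) (hs : s ∈ I v) : x * s ∈ extendedSpan I y p (w + v) := by
  induction hx using AddSubgroup.closure_induction with
  | zero => simp
  | add a b _ _ ha hb => rw [add_mul]; exact add_mem ha hb
  | neg a _ ha => rw [neg_mul]; exact neg_mem ha
  | mem a ha =>
    obtain ⟨i, j, r, hr, hj, h, rfl⟩ := ha
    -- Passing to the exact weight `i + j` frees the induction on `j` from `w`; `v` and `s` must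
    -- vary, since `s` is replaced by `s + e` and `e`.
    refine extendedSpan_antitone (show w + v ≤ i + j + v by omega) ?_
    clear h w
    induction j generalizing v s with
    | zero =>
      exact AddSubgroup.subset_closure ⟨i + v, 0, r * s, hmul _ _ _ hr _ hs, hp0, by omega, by simp⟩
    | succ j ih =>
      obtain ⟨e, he, hes⟩ := hcomm v s hs
      have e1 : r * y ^ (j + 1) * s = r * y ^ j * (s + e) * y + r * y ^ j * e := by
        rw [pow_succ, mul_assoc, mul_assoc (y ^ j), hes]
        noncomm_ring
      rw [e1]
      refine add_mem ?_ ?_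
      · have := mul_generator_mem_extendedSpan hp hp0
          (ih (add_mem hs (hI (Nat.le_succ v) he)) (by omega))
        exact extendedSpan_antitone (by omega) this
      · exact extendedSpan_antitone (by omega) (ih he (by omega))

end Filtration


/-! ### Nilpotency of the augmentation ideal from generators and relations -/

/-- All products of `k` elements `g - 1`, with `g` in `G`, of the group algebra `𝔽_p[G]` vanish. -/
def AugmentationVanishes (p : ℕ) (G : Type*) [Group G] (k : ℕ) : Prop :=
  ∀ l : List G, l.length = k → (l.map fun g => MonoidAlgebra.of (ZMod p) G g - 1).prod = 0

section GroupAlgebra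

variable {p : ℕ} {G : Type*} [Group G]

theorem AugmentationVanishes.mono {k m : ℕ} (h : AugmentationVanishes p G k) (hkm : k ≤ m) :
    AugmentationVanishes p G m := by
  intro l hl
  rw [← List.take_append_drop k l, List.map_append, List.prod_append,
    h _ (by rw [List.length_take]; omega), zero_mul]

/-- A filtration criterion for `AugmentationVanishes`. -/
theorem augmentationVanishes_of_filtration {K : ℕ}
    (E : ℕ → AddSubgroup (MonoidAlgebra (ZMod p) G)) (h1 : 1 ∈ E 0) (hE : E K = ⊥)
    (h : ∀ g : G, ∀ w, ∀ x ∈ E w, x * (MonoidAlgebra.of (ZMod p) G g - 1) ∈ E (w + 1)) :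
    AugmentationVanishes p G K := by
  have key (l : List G) : (l.map fun g => MonoidAlgebra.of (ZMod p) G g - 1).prod ∈ E l.length := by
    induction l using List.reverseRecOn with
    | nil => simpa using h1
    | append_singleton l g ih =>
      rw [List.map_append, List.prod_append, List.length_append]
      simpa using h g _ _ ih
  intro l hl
  have := key l
  rwa [hl, hE, AddSubgroup.mem_bot] at this

/-- Products are handled by `ab - 1 = (a - 1)(b - 1) + (a - 1) + (b - 1)`; inverses are positive
powers or 1, by finiteness. -/
theorem forall_mul_sub_one_mem_of_closure [Finite G] {A : Set G} (hA : Subgroup.closure A = ⊤)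
    (E : ℕ → AddSubgroup (MonoidAlgebra (ZMod p) G)) (hanti : Antitone E)
    (h : ∀ g ∈ A, ∀ w, ∀ x ∈ E w, x * (MonoidAlgebra.of (ZMod p) G g - 1) ∈ E (w + 1)) (g : G) :
    ∀ w, ∀ x ∈ E w, x * (MonoidAlgebra.of (ZMod p) G g - 1) ∈ E (w + 1) := by
  have hg : g ∈ Subgroup.closure A := hA ▸ Subgroup.mem_top g
  have hmul (a b : G)
      (ha : ∀ w, ∀ x ∈ E w, x * (MonoidAlgebra.of (ZMod p) G a - 1) ∈ E (w + 1))
      (hb : ∀ w, ∀ x ∈ E w, x * (MonoidAlgebra.of (ZMod p) G b - 1) ∈ E (w + 1)) :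
      ∀ w, ∀ x ∈ E w, x * (MonoidAlgebra.of (ZMod p) G (a * b) - 1) ∈ E (w + 1) := by
    intro w x hx
    have e : x * (MonoidAlgebra.of (ZMod p) G (a * b) - 1) =
        x * (MonoidAlgebra.of (ZMod p) G a - 1) * (MonoidAlgebra.of (ZMod p) G b - 1) +
        x * (MonoidAlgebra.of (ZMod p) G a - 1) + x * (MonoidAlgebra.of (ZMod p) G b - 1) := by
      rw [map_mul]
      noncomm_ring
    rw [e]
    exact add_mem (add_mem (hanti (Nat.le_succ _) (hb _ _ (ha w x hx))) (ha w x hx)) (hb w x hx)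
  induction hg using Subgroup.closure_induction with
  | mem a ha => exact h a ha
  | one => intro w x _; simp [-MonoidAlgebra.of_apply]
  | mul a b _ _ ha hb => exact hmul a b ha hb
  | inv a _ ha =>
    have hpow (n : ℕ) :
        ∀ w, ∀ x ∈ E w, x * (MonoidAlgebra.of (ZMod p) G (a ^ n) - 1) ∈ E (w + 1) := by
      induction n with
      | zero => intro w x _; simp [-MonoidAlgebra.of_apply]
      | succ n ih => rw [pow_succ]; exact hmul _ _ ih ha
    rw [← mul_one a⁻¹, ← pow_orderOf_eq_one a, ← Nat.sub_add_cancel (orderOf_pos a), pow_succ',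
      inv_mul_cancel_left]
    exact hpow _

theorem pow_sub_one_mem_monomialSpan {R : Type*} [Ring R] {α ζ : R} (hc : Commute α ζ) {c v : ℕ}
    {u : R} (hu : u - 1 ∈ monomialSpan α ζ c v) (n : ℕ) :
    u ^ n - 1 ∈ monomialSpan α ζ c v := by
  induction n with
  | zero => simp
  | succ n ih =>
    have e : u ^ (n + 1) - 1 = (u ^ n - 1) * (u - 1) + (u ^ n - 1) + (u - 1) := by
      rw [pow_succ]; noncomm_ring
    rw [e]
    exact add_mem (add_mem (monomialSpan_antitone α ζ c (by omega)
      (mul_mem_monomialSpan hc ih hu)) ih) hu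

/-- An upper bound for the nilpotency index of the augmentation ideal of a group generated by
`a`, `z`, `g`, where `z` commutes with `a` and `g`, the commutator of `g` and `a` lies in
`⟨a ^ p, z⟩`, and so does `g ^ p`. The bound is a weighted count, with weight `c` for `z`. -/
theorem augmentationVanishes_of_generators [Fact p.Prime] [Finite G] {a z g : G}
    {k l r s c N M : ℕ} (hgen : Subgroup.closure {a, z, g} = ⊤) (haz : Commute a z)
    (hgz : Commute g z) (hconj : g * a = a ^ (p * k + 1) * z ^ l * g)
    (hpow : g ^ p = a ^ (p * r) * z ^ s) (hc : 1 ≤ c) (hl : 2 ≤ c ∨ z ^ l = 1)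
    (hs : p ≤ c ∨ z ^ s = 1) (ha : a ^ p ^ N = 1) (hz : z ^ p ^ M = 1) :
    AugmentationVanishes p G (p ^ N + c * (p ^ M - 1) + p - 1) := by
  have hp : p.Prime := Fact.out
  have : CharP (MonoidAlgebra (ZMod p) G) p :=
    charP_of_injective_algebraMap (algebraMap (ZMod p) _).injective p
  set o := MonoidAlgebra.of (ZMod p) G with ho
  have hcz : Commute (o a - 1) (o z - 1) :=
    ((haz.map o).sub_left (Commute.one_left _)).sub_right (Commute.one_right _)
  have hyz : Commute (o g - 1) (o z - 1) :=
    ((hgz.map o).sub_left (Commute.one_left _)).sub_right (Commute.one_right _)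
  have frob (u : MonoidAlgebra (ZMod p) G) (n : ℕ) : (u - 1) ^ p ^ n = u ^ p ^ n - 1 := by
    rw [sub_pow_char_pow_of_commute (p := p) (h := Commute.one_right u), one_pow]
  have frob1 (u : MonoidAlgebra (ZMod p) G) : (u - 1) ^ p = u ^ p - 1 := by
    simpa using frob u 1
  set I := monomialSpan (o a - 1) (o z - 1) c with hI
  have hIa : Antitone I := monomialSpan_antitone _ _ _
  have hImul {i j : ℕ} {x x'} (hx : x ∈ I i) (hx' : x' ∈ I j) : x * x' ∈ I (i + j) :=
    mul_mem_monomialSpan hcz hx hx'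
  have h1 : (1 : MonoidAlgebra (ZMod p) G) ∈ I 0 := one_mem_monomialSpan _ _ _
  have hα : o a - 1 ∈ I 1 := left_mem_monomialSpan _ _ _
  have hζ : o z - 1 ∈ I c := right_mem_monomialSpan _ _ _
  have hap (n : ℕ) : o a ^ (p * n) - 1 ∈ I p := by
    have := pow_mem_monomialSpan hcz (pow_sub_one_mem_monomialSpan hcz hα n) p
    rwa [frob1, one_mul, ← pow_mul, mul_comm n] at this
  have hzn {q : ℕ} (n : ℕ) (h : q ≤ c ∨ z ^ n = 1) : o z ^ n - 1 ∈ I q := by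
    rcases h with h | h
    · exact hIa h (pow_sub_one_mem_monomialSpan hcz hζ n)
    · rw [← map_pow, h, map_one, sub_self]; exact zero_mem _
  have haz_mem {q : ℕ} (m n : ℕ) (hq : q ≤ p) (h : q ≤ c ∨ z ^ n = 1) :
      o a ^ (p * m) * o z ^ n - 1 ∈ I q := by
    have e : o a ^ (p * m) * o z ^ n - 1 =
        (o a ^ (p * m) - 1) * (o z ^ n - 1) + (o a ^ (p * m) - 1) + (o z ^ n - 1) := by
      noncomm_ring
    rw [e]
    have h1 := hIa hq (hap m)
    have h2 := hzn n h
    exact add_mem (add_mem (hIa (by omega) (hImul h1 h2)) h1) h2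
  -- With `t = a ^ (p * k) * z ^ l` one has `g a = a t g`, so the swap error is `a (t - 1)`. It has
  -- weight 2: `a ^ (p * k) - 1` has weight `p ≥ 2`, and `z ^ l - 1` has weight `c ≥ 2` or vanishes.
  set d := o a * (o a ^ (p * k) * o z ^ l - 1) with hd
  have hd_mem : d ∈ I 2 := by
    have h0 : o a ∈ I 0 := by
      simpa using add_mem (hIa (Nat.zero_le 1) hα) h1
    simpa using hImul h0 (haz_mem k l hp.two_le hl)
  have hyα : (o g - 1) * (o a - 1) = (o a - 1 + d) * (o g - 1) + d := by
    have e : o g * o a = o a * (o a ^ (p * k) * o z ^ l) * o g := by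
      rw [← map_mul, hconj]
      simp only [map_mul, map_pow, pow_succ']
      simp only [mul_assoc]
    rw [hd]
    generalize o a ^ (p * k) * o z ^ l = t at e ⊢
    rw [sub_mul, mul_sub, mul_one, one_mul, e]
    noncomm_ring
  have hcomm : ∀ i, ∀ x ∈ I i, ∃ e ∈ I (i + 1), (o g - 1) * x = (x + e) * (o g - 1) + e :=
    fun i x hx => exists_mul_eq_of_mem_monomialSpan hcz hyz hd_mem hyα hx
  have hgp : (o g - 1) ^ p ∈ I p := by
    rw [frob1, ← map_pow, hpow, map_mul, map_pow, map_pow]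
    exact haz_mem r s le_rfl hs
  have hyp : ∀ i, ∀ x ∈ I i, x * (o g - 1) ^ p ∈ I (i + p) := fun i x hx => hImul hx hgp
  have hmem {w v : ℕ} {x s : MonoidAlgebra (ZMod p) G} (hx : x ∈ extendedSpan I (o g - 1) p w)
      (hs : s ∈ I v) : x * s ∈ extendedSpan I (o g - 1) p (w + v) :=
    mul_mem_extendedSpan hIa (fun i j x hx x' hx' => hImul hx hx') hcomm hyp hp.pos hx hs
  refine augmentationVanishes_of_filtration (extendedSpan I (o g - 1) p) ?_ ?_ ?_
  · exact AddSubgroup.subset_closure ⟨0, 0, 1, h1, hp.pos, by omega, by simp⟩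
  · refine extendedSpan_eq_bot (m := p ^ N + c * (p ^ M - 1)) (fun i hi => ?_) le_rfl
    exact monomialSpan_eq_bot (by rw [frob, ← map_pow, ha, map_one, sub_self])
      (by rw [frob, ← map_pow, hz, map_one, sub_self]) hi
  · refine forall_mul_sub_one_mem_of_closure hgen _ extendedSpan_antitone ?_
    rintro h (rfl | rfl | rfl) w x hx
    · exact hmem hx hα
    · exact hmem hx (hIa hc hζ)
    · exact mul_generator_mem_extendedSpan hyp hp.pos hx

end GroupAlgebra

/-! ### Lifting a bound from a central quotient -/

section Quotient

variable {p : ℕ} {G Q : Type*} [Group G] [Group Q]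

/-- The kernel of `𝔽_p[G] → 𝔽_p[Q]` is generated by `z - 1` when `G → Q` is surjective with kernel
the finite cyclic group generated by `z`. -/
theorem exists_sub_one_mul_eq_of_mapDomainRingHom_eq_zero {f : G →* Q}
    (hf : Function.Surjective f) {z : G} (hker : f.ker = Subgroup.zpowers z) (hfin : IsOfFinOrder z)
    {x : MonoidAlgebra (ZMod p) G} (hx : MonoidAlgebra.mapDomainRingHom (ZMod p) f x = 0) :
    ∃ y, x = (MonoidAlgebra.of (ZMod p) G z - 1) * y := by
  -- Choosing coset representatives, each `g` is `z ^ n * h` with `h` the representative, and `z -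
  -- 1` divides `z ^ n - 1`.
  have key (x : MonoidAlgebra (ZMod p) G) : ∃ y, x = MonoidAlgebra.mapDomain (Function.surjInv hf)
      (MonoidAlgebra.mapDomain f x) + (MonoidAlgebra.of (ZMod p) G z - 1) * y := by
    induction x using MonoidAlgebra.induction_linear with
    | zero => exact ⟨0, by simp⟩
    | add x y hx hy =>
      obtain ⟨u, hu⟩ := hx
      obtain ⟨v, hv⟩ := hy
      refine ⟨u + v, ?_⟩
      rw [MonoidAlgebra.mapDomain_add, MonoidAlgebra.mapDomain_add, mul_add]
      nth_rewrite 1 [hu, hv]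
      abel
    | single g r =>
      set h := Function.surjInv hf (f g) with hh
      have hmem : g * h⁻¹ ∈ Subgroup.zpowers z := by
        rw [← hker, MonoidHom.mem_ker, map_mul, map_inv, hh, Function.surjInv_eq hf, mul_inv_cancel]
      obtain ⟨n, hn⟩ := hfin.mem_powers_iff_mem_zpowers.mpr hmem
      refine ⟨(∑ i ∈ Finset.range n, MonoidAlgebra.of (ZMod p) G z ^ i) * MonoidAlgebra.single h r,
        ?_⟩
      have hg : g = z ^ n * h := by
        change z ^ n = _ at hn
        rw [hn, inv_mul_cancel_right]
      rw [← mul_assoc, mul_geom_sum, MonoidAlgebra.mapDomain_single, MonoidAlgebra.mapDomain_single,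
        ← hh, ← map_pow, sub_mul, one_mul, MonoidAlgebra.of_apply, MonoidAlgebra.single_mul_single,
        one_mul, ← hg]
      abel
  obtain ⟨y, hy⟩ := key x
  refine ⟨y, ?_⟩
  have h0 : MonoidAlgebra.mapDomain f x = 0 := hx
  rwa [h0, MonoidAlgebra.mapDomain_zero, zero_add] at hy

/-- Each block of `k` factors dies in `Q`, so it is a multiple of the central element `ζ = z - 1`;
`p` blocks give `ζ ^ p = z ^ p - 1 = 0`. -/
theorem AugmentationVanishes.of_quotient [Fact p.Prime] {f : G →* Q} (hf : Function.Surjective f)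
    {z : G} (hker : f.ker = Subgroup.zpowers z) (hcomm : ∀ g, Commute z g) (hz : z ^ p = 1) {k : ℕ}
    (h : AugmentationVanishes p Q k) : AugmentationVanishes p G (p * k) := by
  have hp : p.Prime := Fact.out
  have : CharP (MonoidAlgebra (ZMod p) G) p :=
    charP_of_injective_algebraMap (algebraMap (ZMod p) _).injective p
  set ζ := MonoidAlgebra.of (ZMod p) G z - 1 with hζ
  have hζp : ζ ^ p = 0 := by
    rw [hζ, sub_pow_char_of_commute (p := p) (h := Commute.one_right _), one_pow, ← map_pow, hz,
      map_one, sub_self]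
  have hζc (x) : Commute ζ x := (MonoidAlgebra.of_commute hcomm x).sub_left (Commute.one_left x)
  have key (m : ℕ) : ∀ l : List G, l.length = m * k →
      ∃ y, (l.map fun g => MonoidAlgebra.of (ZMod p) G g - 1).prod = ζ ^ m * y := by
    induction m with
    | zero => intro l _; exact ⟨_, by rw [pow_zero, one_mul]⟩
    | succ m ih =>
      intro l hl
      rw [Nat.succ_mul] at hl
      obtain ⟨y, hy⟩ := ih (l.drop k) (by rw [List.length_drop]; omega)
      obtain ⟨y', hy'⟩ := exists_sub_one_mul_eq_of_mapDomainRingHom_eq_zero hf hker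
        (isOfFinOrder_iff_pow_eq_one.mpr ⟨p, hp.pos, hz⟩)
        (x := ((l.take k).map fun g => MonoidAlgebra.of (ZMod p) G g - 1).prod) (by
          rw [map_list_prod, List.map_map]
          have := h ((l.take k).map f) (by simp; omega)
          rw [List.map_map] at this
          rw [← this]
          congr 2
          ext1 g
          simp [map_sub, -MonoidAlgebra.mapDomainRingHom_apply, -MonoidAlgebra.of_apply]
          simp)
      refine ⟨y' * y, ?_⟩
      rw [← List.take_append_drop k l, List.map_append, List.prod_append, hy, hy', ← hζ,
        pow_succ', mul_assoc, ← mul_assoc y', ← ((hζc y').pow_left m).eq]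
      simp only [mul_assoc]
  intro l hl
  obtain ⟨y, hy⟩ := key p l hl
  rw [hy, hζp, zero_mul]

end Quotient

/-! ### The augmentation ideal and the Jacobson radical -/

section Radical

variable (p : ℕ) (G : Type*) [Group G]

/-- The linear span of the elements `g - 1` of `𝔽_p[G]`, that is, the augmentation ideal. -/
noncomputable def augmentationSpan : Submodule (ZMod p) (MonoidAlgebra (ZMod p) G) :=
  Submodule.span (ZMod p) (Set.range fun g => MonoidAlgebra.of (ZMod p) G g - 1)

/-- The augmentation map `𝔽_p[G] → 𝔽_p`. -/
noncomputable def augmentation : MonoidAlgebra (ZMod p) G →ₐ[ZMod p] ZMod p :=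
  MonoidAlgebra.lift (ZMod p) (ZMod p) G 1

variable {p G}

@[simp]
theorem augmentation_of (g : G) : augmentation p G (MonoidAlgebra.of (ZMod p) G g) = 1 := by
  simp [augmentation]

theorem mem_augmentationSpan_of_augmentation_eq_zero {x : MonoidAlgebra (ZMod p) G}
    (hx : augmentation p G x = 0) : x ∈ augmentationSpan p G := by
  have key (x : MonoidAlgebra (ZMod p) G) :
      x - algebraMap (ZMod p) _ (augmentation p G x) ∈ augmentationSpan p G := by
    induction x using MonoidAlgebra.induction_on with
    | of g =>
      rw [augmentation_of, map_one]
      exact Submodule.subset_span ⟨g, rfl⟩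
    | add x y hx hy =>
      rw [map_add, map_add, add_sub_add_comm]
      exact add_mem hx hy
    | smul r x hx =>
      rw [map_smul, smul_eq_mul, map_mul, ← Algebra.smul_def, ← smul_sub]
      exact Submodule.smul_mem _ _ hx
  simpa [hx] using key x

theorem jacobson_le_augmentationSpan [Fact p.Prime] {x : MonoidAlgebra (ZMod p) G}
    (hx : x ∈ Ring.jacobson (MonoidAlgebra (ZMod p) G)) : x ∈ augmentationSpan p G := by
  refine mem_augmentationSpan_of_augmentation_eq_zero ?_
  have hs : Function.Surjective (augmentation p G : MonoidAlgebra (ZMod p) G →+* ZMod p) := fun r =>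
    ⟨algebraMap (ZMod p) _ r, (augmentation p G).commutes r⟩
  have : RingHomSurjective (augmentation p G : MonoidAlgebra (ZMod p) G →+* ZMod p) := ⟨hs⟩
  have h := Ring.le_comap_jacobson (augmentation p G : MonoidAlgebra (ZMod p) G →+* ZMod p) hx
  have hbot : Ring.jacobson (ZMod p) = ⊥ := IsSemisimpleRing.jacobson_eq_bot _
  rw [hbot] at h
  simpa using h

theorem augmentationSpan_pow_eq_bot {k : ℕ} (h : AugmentationVanishes p G k) :
    augmentationSpan p G ^ k = ⊥ := by
  rw [augmentationSpan, Submodule.span_pow, Submodule.span_eq_bot]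
  intro x hx
  obtain ⟨f, rfl⟩ := Set.mem_pow.mp hx
  choose g hg using fun i => (f i).2
  have := h (List.ofFn g) (by simp)
  rw [List.map_ofFn] at this
  rw [← this]
  congr 2
  ext1 i
  exact (hg i).symm

theorem jacobson_pow_eq_zero [Fact p.Prime] {k : ℕ} (h : AugmentationVanishes p G k) :
    Ring.jacobson (MonoidAlgebra (ZMod p) G) ^ k = 0 := by
  -- Exponent 0 is set apart: the zeroth power of the radical is the whole ring, that of
  -- `augmentationSpan p G` only the scalars.
  rcases Nat.eq_zero_or_pos k with rfl | hk
  · have : (1 : MonoidAlgebra (ZMod p) G) = 0 := h [] rfl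
    exact absurd this one_ne_zero
  have key : ∀ n, 1 ≤ n → ∀ x ∈ Ring.jacobson (MonoidAlgebra (ZMod p) G) ^ n,
      x ∈ augmentationSpan p G ^ n := by
    intro n hn
    induction n, hn using Nat.le_induction with
    | base =>
      intro x hx
      rw [Submodule.pow_one] at hx
      rw [pow_one]
      exact jacobson_le_augmentationSpan hx
    | succ n hn ih =>
      intro x hx
      rw [Submodule.pow_succ] at hx
      rw [pow_succ]
      refine Submodule.smul_induction_on hx (fun r hr s hs => ?_) fun _ _ => add_mem
      exact Submodule.mul_mem_mul (ih r hr) (jacobson_le_augmentationSpan hs)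
  refine (Submodule.eq_bot_iff _).mpr fun x hx => ?_
  have := key k hk x hx
  rwa [augmentationSpan_pow_eq_bot h, Submodule.mem_bot] at this

/-- If a maximal left ideal omitted `g - 1`, it would contain some `1 - r (g - 1)`; this is a unit,
since `r (g - 1)` has augmentation 0 and so is nilpotent. -/
theorem of_sub_one_mem_jacobson {k : ℕ} (h : AugmentationVanishes p G k) (g : G) :
    MonoidAlgebra.of (ZMod p) G g - 1 ∈ Ring.jacobson (MonoidAlgebra (ZMod p) G) := by
  rw [Ring.jacobson_eq_sInf_isMaximal, Submodule.mem_sInf]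
  intro m hm
  by_contra hg
  obtain ⟨r, i, hi, hri⟩ := Ideal.IsMaximal.exists_inv hm hg
  have haug : r * (MonoidAlgebra.of (ZMod p) G g - 1) ∈ augmentationSpan p G :=
    mem_augmentationSpan_of_augmentation_eq_zero (by
      rw [map_mul, map_sub, augmentation_of, map_one, sub_self, mul_zero])
  have hnil : IsNilpotent (r * (MonoidAlgebra.of (ZMod p) G g - 1)) := by
    refine ⟨k, ?_⟩
    have := Submodule.pow_mem_pow _ haug k
    rwa [augmentationSpan_pow_eq_bot h, Submodule.mem_bot] at this
  have hu := hnil.isUnit_one_sub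
  rw [← eq_sub_of_add_eq' hri] at hu
  exact hm.ne_top (Ideal.eq_top_of_isUnit_mem _ hi hu)

theorem loewyLength_le [Fact p.Prime] {k : ℕ} (h : AugmentationVanishes p G k) :
    loewyLength p G ≤ k :=
  Nat.sInf_le (jacobson_pow_eq_zero h)

theorem augmentationVanishes_loewyLength [Fact p.Prime] {k : ℕ}
    (h : AugmentationVanishes p G k) : AugmentationVanishes p G (loewyLength p G) := by
  have h0 : Ring.jacobson (MonoidAlgebra (ZMod p) G) ^ loewyLength p G = 0 :=
    Nat.sInf_mem (s := {k | Ring.jacobson (MonoidAlgebra (ZMod p) G) ^ k = 0})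
      ⟨k, jacobson_pow_eq_zero h⟩
  have key (l : List G) : (l.map fun g => MonoidAlgebra.of (ZMod p) G g - 1).prod ∈
      Ring.jacobson (MonoidAlgebra (ZMod p) G) ^ l.length := by
    induction l with
    | nil => rw [List.length_nil, Submodule.pow_zero, Ideal.one_eq_top]; exact Submodule.mem_top
    | cons g l ih =>
      rw [List.length_cons, Ideal.IsTwoSided.pow_succ, List.map_cons, List.prod_cons]
      exact Ideal.mul_mem_mul (of_sub_one_mem_jacobson h g) ih
  intro l hl
  have := key l
  rwa [hl, h0] at this

end Radical

/-! ### Comparing d, D_o and L -/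

section Davenport

variable {p : ℕ} {G : Type*} [Group G]

theorem smallDavenport_lt_orderedDavenport [Finite G] :
    smallDavenport G < orderedDavenport G := by
  obtain ⟨S, hS, h⟩ := Nat.sSup_mem
    (s := {n : ℕ | ∃ S : Multiset G, S.card = n ∧ (1 : G) ∉ seqSubproducts S})
    ⟨0, 0, rfl, by
      rintro ⟨T, hT, hT1, _⟩
      rw [Multiset.le_zero.mp hT] at hT1
      simp at hT1⟩ bddAbove_smallDavenport
  have hD : ∀ l : List G, orderedDavenport G ≤ l.length → (1 : G) ∈ orderedSubproducts l :=
    Nat.sInf_mem (s := {k : ℕ | ∀ l : List G, k ≤ l.length → (1 : G) ∈ orderedSubproducts l})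
      ⟨Nat.card G, one_mem_orderedSubproducts⟩
  by_contra! hle
  induction S using Quotient.inductionOn with
  | h l =>
    obtain ⟨T, hT, hlen, hprod⟩ := hD l (hle.trans_eq (by simpa [smallDavenport] using hS.symm))
    exact h ⟨T, Multiset.coe_le.mpr hT.subperm, by simpa using hlen, T, rfl, hprod⟩

theorem le_smallDavenport [Finite G] {S : Multiset G} (hS : (1 : G) ∉ seqSubproducts S) :
    S.card ≤ smallDavenport G :=
  le_csSup bddAbove_smallDavenport ⟨S, rfl, hS⟩

/-- In the expanded product, every term except the constant one is, up to sign, a nonempty ordered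
subproduct. -/
theorem prod_of_sub_one_mem_span (l : List G) :
    (l.map fun g => MonoidAlgebra.of (ZMod p) G g - 1).prod - (-1) ^ l.length ∈
      AddSubgroup.closure (MonoidAlgebra.of (ZMod p) G '' orderedSubproducts l) := by
  induction l with
  | nil => simp
  | cons g l ih =>
    set P := (l.map fun g => MonoidAlgebra.of (ZMod p) G g - 1).prod with hP
    have hsub : orderedSubproducts l ⊆ orderedSubproducts (g :: l) := by
      rintro x ⟨T, hT, h1, rfl⟩
      exact ⟨T, hT.cons g, h1, rfl⟩
    have hg : MonoidAlgebra.of (ZMod p) G g ∈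
        AddSubgroup.closure (MonoidAlgebra.of (ZMod p) G '' orderedSubproducts (g :: l)) :=
      AddSubgroup.subset_closure ⟨g, ⟨[g], by simp, by simp, by simp⟩, rfl⟩
    have hmul : MonoidAlgebra.of (ZMod p) G g * (P - (-1) ^ l.length) ∈
        AddSubgroup.closure (MonoidAlgebra.of (ZMod p) G '' orderedSubproducts (g :: l)) := by
      generalize P - (-1) ^ l.length = x at ih
      induction ih using AddSubgroup.closure_induction with
      | zero => simp
      | add a b _ _ ha hb => rw [mul_add]; exact add_mem ha hb
      | neg a _ ha => rw [mul_neg]; exact neg_mem ha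
      | mem a ha =>
        obtain ⟨x, ⟨T, hT, h1, rfl⟩, rfl⟩ := ha
        rw [← map_mul]
        exact AddSubgroup.subset_closure ⟨_, ⟨g :: T, hT.cons_cons g, by simp, by simp⟩, rfl⟩
    have e : (List.map (fun g => MonoidAlgebra.of (ZMod p) G g - 1) (g :: l)).prod -
        (-1) ^ (g :: l).length = MonoidAlgebra.of (ZMod p) G g * (P - (-1) ^ l.length) -
          (P - (-1) ^ l.length) + MonoidAlgebra.of (ZMod p) G g * (-1) ^ l.length := by
      rw [List.map_cons, List.prod_cons, ← hP, List.length_cons, pow_succ]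
      noncomm_ring
    rw [e]
    refine add_mem (sub_mem hmul (AddSubgroup.closure_mono (Set.image_mono hsub) ih)) ?_
    rcases neg_one_pow_eq_or (MonoidAlgebra (ZMod p) G) l.length with h | h
    · rwa [h, mul_one]
    · rw [h, mul_neg, mul_one]
      exact neg_mem hg

/-- If 1 were not a subproduct, the vanishing product would make `±1` a combination of group
elements other than 1, contradicting its coefficient at 1. -/
theorem orderedDavenport_le [Fact p.Prime] {k : ℕ} (h : AugmentationVanishes p G k) :
    orderedDavenport G ≤ k := by
  refine Nat.sInf_le fun l hl => ?_
  by_contra h1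
  have hmem := prod_of_sub_one_mem_span (p := p) l
  rw [h.mono hl l rfl, zero_sub] at hmem
  have hcoeff : ∀ x ∈ AddSubgroup.closure (MonoidAlgebra.of (ZMod p) G '' orderedSubproducts l),
      x.coeff 1 = 0 := by
    intro x hx
    induction hx using AddSubgroup.closure_induction with
    | zero => simp
    | add a b _ _ ha hb => simp [ha, hb]
    | neg a _ ha => simp [ha]
    | mem a ha =>
      obtain ⟨g, hg, rfl⟩ := ha
      have : g ≠ 1 := fun h => h1 (h ▸ hg)
      simp [this]
  have := hcoeff _ hmem
  rcases neg_one_pow_eq_or (MonoidAlgebra (ZMod p) G) l.length with h | h <;> simp [h] at this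

end Davenport

/-! ### Relations in p-groups with a cyclic subgroup of index p -/

section PGroup

variable {p : ℕ} {G : Type*} [Group G]

theorem Subgroup.eq_top_of_lt_of_index_eq_prime (hp : p.Prime) {H K : Subgroup G}
    (hH : H.index = p) (hHK : H ≤ K) {g : G} (hgK : g ∈ K) (hgH : g ∉ H) : K = ⊤ := by
  have h := Subgroup.relIndex_mul_index hHK
  rw [hH] at h
  rcases (Nat.dvd_prime hp).mp (Dvd.intro_left _ h) with h1 | h1
  · exact Subgroup.index_eq_one.mp h1
  · rw [h1] at h
    have : H.relIndex K = 1 := Nat.eq_of_mul_eq_mul_right hp.pos (by omega)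
    exact absurd (Subgroup.relIndex_eq_one.mp this hgK) hgH

variable [Finite G]

theorem Subgroup.normal_of_index_eq_prime_of_isPGroup (hp : p.Prime) (hG : IsPGroup p G)
    {H : Subgroup G} (hH : H.index = p) : H.Normal := by
  have := Fact.mk hp
  obtain ⟨n, hn⟩ := IsPGroup.iff_card.mp hG
  refine Subgroup.normal_of_index_eq_minFac_card ?_
  have hn0 : n ≠ 0 := by
    rintro rfl
    have := H.index_dvd_card
    rw [hH, hn, pow_zero, Nat.dvd_one] at this
    exact hp.one_lt.ne' this
  rw [hH, hn, hp.pow_minFac hn0]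

/-- A noncyclic `p`-group with a cyclic subgroup `⟨a⟩` of index `p`: for `g ∉ ⟨a⟩`, both `g ^ p` and
the commutator of `g` and `a` are powers of `a ^ p`. -/
theorem exists_relations_of_index_zpowers_eq (hp : p.Prime) (hG : IsPGroup p G)
    (hnc : ¬ IsCyclic G) {a g : G} (ha : (Subgroup.zpowers a).index = p)
    (hg : g ∉ Subgroup.zpowers a) :
    ∃ k r : ℕ, g * a = a ^ (p * k + 1) * g ∧ g ^ p = a ^ (p * r) := by
  have := Fact.mk hp
  have hN : (Subgroup.zpowers a).Normal :=
    Subgroup.normal_of_index_eq_prime_of_isPGroup hp hG ha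
  have hnat {x : G} (hx : x ∈ Subgroup.zpowers a) : ∃ n : ℕ, a ^ n = x :=
    (isOfFinOrder_of_finite a).mem_powers_iff_mem_zpowers.mpr hx
  obtain ⟨m, hm⟩ := hnat (hN.conj_mem a (Subgroup.mem_zpowers a) g)
  obtain ⟨t, ht⟩ := hnat (ha ▸ Subgroup.pow_index_mem (Subgroup.zpowers a) g)
  obtain ⟨i, hi⟩ := IsPGroup.iff_orderOf.mp hG a
  obtain ⟨j, hj⟩ := IsPGroup.iff_orderOf.mp hG g
  have hcard : p ^ i * p = Nat.card G := by
    rw [← Subgroup.card_mul_index (Subgroup.zpowers a), ha, Nat.card_zpowers, hi]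
  have hga : g * a = a ^ m * g := by rw [hm, inv_mul_cancel_right]
  -- Otherwise `g ^ p` has the order of `a`, so `g` has order `p * orderOf a = |G|` and the group is
  -- cyclic.
  have hpt : p ∣ t := by
    by_contra hpt
    have hcop : (orderOf a).Coprime t := by
      rw [hi]
      exact ((Nat.Prime.coprime_iff_not_dvd hp).mpr hpt).pow_left i
    have hgo : orderOf (g ^ p) = p ^ i := by rw [← ht, hcop.orderOf_pow, hi]
    rcases j with - | j
    · rw [pow_zero, orderOf_eq_one_iff] at hj
      exact hg (hj ▸ one_mem _)
    · rw [orderOf_pow, hj, pow_succ, Nat.gcd_mul_left_left, Nat.mul_div_cancel _ hp.pos] at hgo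
      refine hnc (isCyclic_of_orderOf_eq_card g ?_)
      rw [hj, pow_succ, hgo, hcard]
  obtain ⟨r, rfl⟩ := hpt
  rcases i with - | i
  · rw [pow_zero, orderOf_eq_one_iff] at hi
    subst hi
    exact ⟨0, r, by simp, ht.symm⟩
  have hconj (n : ℕ) : g ^ n * a = a ^ m ^ n * g ^ n := by
    induction n with
    | zero => simp
    | succ n ih =>
      have hpow (q : ℕ) : g * a ^ q = (a ^ m) ^ q * g := by
        have : SemiconjBy g a (a ^ m) := hga
        exact this.pow_right q
      rw [pow_succ', mul_assoc, ih, ← mul_assoc, hpow, ← pow_mul, mul_assoc, pow_succ' m]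
  -- `g ^ p` is a power of `a`, hence commutes with it. Fermat then gives `m ≡ m ^ p ≡ 1` modulo
  -- `p`.
  have hmp : a ^ m ^ p = a ^ 1 := by
    have h := hconj p
    rw [← ht, ← pow_succ, pow_succ'] at h
    rw [pow_one]
    exact (mul_right_cancel h).symm
  have hmod : m ≡ 1 [MOD p] := by
    have h1 : m ^ p ≡ 1 [MOD p] :=
      (pow_eq_pow_iff_modEq.mp hmp).of_dvd (by rw [hi, pow_succ]; exact dvd_mul_left _ _)
    have h2 := (ZMod.natCast_eq_natCast_iff _ _ _).mpr h1
    rw [Nat.cast_pow, ZMod.pow_card] at h2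
    exact (ZMod.natCast_eq_natCast_iff _ _ _).mp h2
  have hm1 : 1 ≤ m := by
    rcases Nat.eq_zero_or_pos m with rfl | h
    · exact absurd (Nat.dvd_one.mp (Nat.modEq_zero_iff_dvd.mp hmod.symm)) hp.one_lt.ne'
    · exact h
  obtain ⟨k, hk⟩ := (Nat.modEq_iff_dvd' hm1).mp hmod.symm
  exact ⟨k, r, by rw [hga]; congr 2; omega, ht.symm⟩

theorem isCyclic_or_exists_of_le_orderOf (hp : p.Prime) {n : ℕ} (hn : Nat.card G = p ^ (n + 1))
    {a : G} (ha : p ^ n ≤ orderOf a) :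
    IsCyclic G ∨ ∃ H : Subgroup G, IsCyclic H ∧ H.index = p := by
  obtain ⟨j, hj, hja⟩ := (Nat.dvd_prime_pow hp).mp (hn ▸ orderOf_dvd_natCard a)
  rw [hja, Nat.pow_le_pow_iff_right hp.one_lt] at ha
  rcases Nat.lt_or_ge n j with h | h
  · left
    refine isCyclic_of_orderOf_eq_card a ?_
    rw [hja, hn, show j = n + 1 by omega]
  · right
    refine ⟨Subgroup.zpowers a, inferInstance, ?_⟩
    have h1 := (Subgroup.zpowers a).card_mul_index
    rw [Nat.card_zpowers, hja, hn, show j = n by omega, pow_succ] at h1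
    exact Nat.eq_of_mul_eq_mul_left (pow_pos hp.pos n) h1

theorem exists_central_orderOf_eq_prime (hp : p.Prime) (hG : IsPGroup p G) [Nontrivial G] :
    ∃ z : G, orderOf z = p ∧ ∀ g, Commute z g := by
  have := Fact.mk hp
  have := hG.center_nontrivial
  have hdvd : p ∣ Nat.card (Subgroup.center G) :=
    ((hG.to_subgroup _).card_eq_or_dvd).resolve_left Finite.one_lt_card.ne'
  obtain ⟨z, hz⟩ := exists_prime_orderOf_dvd_card' p hdvd
  exact ⟨z, by rw [Subgroup.orderOf_coe, hz], fun g => (Subgroup.mem_center_iff.mp z.2 g).symm⟩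

/-- The weighted bound, for a group of order `p ^ (n + 1)` in which all elements have order less
than `p ^ n`, and whose quotient by a central subgroup of order `p` is not cyclic but has a cyclic
subgroup of index `p`. -/
theorem augmentationVanishes_of_quotient_relations [Fact p.Prime] {n : ℕ} (hn : 2 ≤ n)
    (hord : ∀ x : G, x ^ p ^ (n - 1) = 1) {a z g : G} {k r l s : ℕ}
    (hgen : Subgroup.closure {a, z, g} = ⊤) (hz : z ^ p = 1) (hcomm : ∀ g, Commute z g)
    (hconj : g * a = a ^ (p * k + 1) * z ^ l * g) (hpow : g ^ p = a ^ (p * r) * z ^ s) :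
    AugmentationVanishes p G (p ^ n) := by
  have hp : p.Prime := Fact.out
  have hp2 := hp.two_le
  have hz1 : z ^ p ^ 1 = 1 := by rwa [pow_one]
  rcases hn.eq_or_lt with rfl | hn3
  -- In exponent `p`, weight `p - 1` for `z` makes the bound `p + (p - 1) ^ 2 + p - 1` exactly `p ^
  -- 2`; weight `p` would overshoot.
  · have hexp (x : G) : x ^ p = 1 := by simpa using hord x
    have hl : 2 ≤ p - 1 ∨ z ^ l = 1 := by
      -- For `p = 2` the weight of `z` is only 1, but exponent 2 makes the group abelian.
      rcases hp2.eq_or_lt with rfl | h3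
      · right
        have hga : g * a = a * g := by
          have hinv (x : G) : x⁻¹ = x := inv_eq_of_mul_eq_one_left (by rw [← sq, hexp])
          rw [← hinv (g * a), mul_inv_rev, hinv, hinv]
        rw [pow_succ, pow_mul, hexp, one_pow, one_mul, hga] at hconj
        have := mul_right_cancel hconj
        exact (mul_eq_left.mp this.symm)
      · left; omega
    have hs : z ^ s = 1 := by
      rw [hexp, pow_mul, hexp, one_pow, one_mul] at hpow
      exact hpow.symm
    have h := augmentationVanishes_of_generators (c := p - 1) (N := 1) (M := 1) hgen
      (hcomm a).symm (hcomm g).symm hconj hpow (by omega) hl (Or.inr hs) (by simpa using hexp a) hz1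
    refine h.mono ?_
    obtain ⟨q, rfl⟩ : ∃ q, p = q + 1 := ⟨p - 1, by omega⟩
    simp only [pow_one, Nat.add_sub_cancel]
    have : (q + 1) ^ 2 = q + 1 + q * q + q := by ring
    omega
  -- For `n ≥ 3` weight `p` fits: `p ^ (n - 1) + p ^ 2 - 1 ≤ p ^ n`.
  · have h := augmentationVanishes_of_generators (c := p) (N := n - 1) (M := 1) hgen
      (hcomm a).symm (hcomm g).symm hconj hpow hp.pos (Or.inl hp2) (Or.inl le_rfl) (hord a) hz1
    refine h.mono ?_
    obtain ⟨q, rfl⟩ : ∃ q, p = q + 1 := ⟨p - 1, by omega⟩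
    obtain ⟨m, rfl⟩ : ∃ m, n = m + 3 := ⟨n - 3, by omega⟩
    simp only [pow_one, Nat.add_sub_cancel, show m + 3 - 1 = m + 2 by omega]
    have h1 : (q + 1) ^ 2 ≤ (q + 1) ^ (m + 2) := Nat.pow_le_pow_right (by omega) (by omega)
    have h2 : (q + 1) ^ 2 * q ≤ (q + 1) ^ (m + 2) * q := Nat.mul_le_mul_right q h1
    have h3 : (q + 1) ^ (m + 3) = (q + 1) ^ (m + 2) + (q + 1) ^ (m + 2) * q := by ring
    have h4 : (q + 1) ^ 2 * 1 ≤ (q + 1) ^ 2 * q := Nat.mul_le_mul_left _ (by omega)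
    have h5 : (q + 1) ^ 2 = (q + 1) * q + (q + 1) := by ring
    omega

end PGroup

/-! ### Induction on the order -/

/-- A finite `p`-group is cyclic, or it has a cyclic subgroup of index `p`, or the nilpotency index
of its augmentation ideal is at most `|G| / p`. -/
theorem isCyclic_or_exists_or_augmentationVanishes {p : ℕ} (hp : p.Prime) (n : ℕ) :
    ∀ (G : Type*) [Group G] [Finite G], Nat.card G = p ^ n →
      IsCyclic G ∨ (∃ H : Subgroup G, IsCyclic H ∧ H.index = p) ∨
        AugmentationVanishes p G (p ^ (n - 1)) := by
  have := Fact.mk hp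
  induction n with
  | zero =>
    intro G _ _ hn
    have := (Nat.card_eq_one_iff_unique.mp (by simpa using hn)).1
    exact Or.inl inferInstance
  | succ n ih =>
    intro G _ _ hn
    have hG : IsPGroup p G := IsPGroup.of_card hn
    have : Nontrivial G := hG.nontrivial_iff_card.mpr ⟨n + 1, by omega, hn⟩
    by_cases hord : ∃ x : G, p ^ n ≤ orderOf x
    · obtain ⟨x, hx⟩ := hord
      rcases isCyclic_or_exists_of_le_orderOf hp hn hx with h | h
      · exact Or.inl h
      · exact Or.inr (Or.inl h)
    push Not at hord
    obtain ⟨z, hz, hcomm⟩ := exists_central_orderOf_eq_prime hp hG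
    have hzp : z ^ p = 1 := hz ▸ pow_orderOf_eq_one z
    have hZ : (Subgroup.zpowers z).Normal := by
      refine ⟨fun x hx g => ?_⟩
      obtain ⟨i, rfl⟩ := hx
      have : g * z ^ i * g⁻¹ = z ^ i := by
        rw [← ((hcomm g).zpow_left i).eq, mul_inv_cancel_right]
      exact this ▸ ⟨i, rfl⟩
    set f := QuotientGroup.mk' (Subgroup.zpowers z) with hf
    have hfs : Function.Surjective f := QuotientGroup.mk'_surjective _
    have hker : f.ker = Subgroup.zpowers z := QuotientGroup.ker_mk' _
    have hQ : Nat.card (G ⧸ Subgroup.zpowers z) = p ^ n := by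
      have h := Subgroup.card_eq_card_quotient_mul_card_subgroup (Subgroup.zpowers z)
      rw [hn, Nat.card_zpowers, hz, pow_succ] at h
      exact (Nat.eq_of_mul_eq_mul_right hp.pos h).symm
    have hQp : IsPGroup p (G ⧸ Subgroup.zpowers z) := IsPGroup.of_card hQ
    have hlift {x y : G} (h : f x = f y) : ∃ i : ℕ, x = z ^ i * y := by
      have hmem : x * y⁻¹ ∈ Subgroup.zpowers z := by
        rw [← hker, MonoidHom.mem_ker, map_mul, map_inv, h, mul_inv_cancel]
      obtain ⟨i, hi⟩ := (isOfFinOrder_of_finite z).mem_powers_iff_mem_zpowers.mpr hmem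
      change z ^ i = _ at hi
      exact ⟨i, by rw [hi, inv_mul_cancel_right]⟩
    -- A lift of a generator would have order at least `p ^ n`.
    have hQnc : ¬ IsCyclic (G ⧸ Subgroup.zpowers z) := by
      intro h
      obtain ⟨q, hq⟩ := h.exists_ofOrder_eq_natCard
      obtain ⟨x, rfl⟩ := hfs q
      have := Nat.le_of_dvd (orderOf_pos x) (orderOf_map_dvd f x)
      rw [hq, hQ] at this
      exact (hord x).not_ge this
    have hn2 : 2 ≤ n := by
      by_contra! hlt
      interval_cases n
      · have := (Nat.card_eq_one_iff_unique.mp (by simpa using hQ)).1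
        exact hQnc inferInstance
      · exact hQnc (isCyclic_of_prime_card (p := p) (by simpa using hQ))
    right; right
    rw [Nat.add_sub_cancel]
    rcases ih (G ⧸ Subgroup.zpowers z) hQ with h | ⟨H, hH, hHi⟩ | h
    · exact absurd h hQnc
    · obtain ⟨q, rfl⟩ := (Subgroup.isCyclic_iff_exists_zpowers_eq_top H).mp hH
      obtain ⟨a, rfl⟩ := hfs q
      obtain ⟨q', hq'⟩ : ∃ q', q' ∉ Subgroup.zpowers (f a) := by
        by_contra! h
        rw [(Subgroup.eq_top_iff' _).mpr h, Subgroup.index_top] at hHi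
        exact hp.one_lt.ne hHi
      obtain ⟨g, rfl⟩ := hfs q'
      obtain ⟨k, r, hk, hr⟩ := exists_relations_of_index_zpowers_eq hp hQp hQnc hHi hq'
      obtain ⟨l, hl⟩ := hlift (x := g * a) (y := a ^ (p * k + 1) * g) (by simpa using hk)
      obtain ⟨s, hs⟩ := hlift (x := g ^ p) (y := a ^ (p * r)) (by simpa using hr)
      -- The closure contains `f.ker`, and its image properly contains the maximal subgroup
      -- generated by `f a`.
      have hgen : Subgroup.closure {a, z, g} = ⊤ := by
        have hle : f.ker ≤ Subgroup.closure {a, z, g} := by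
          rw [hker, Subgroup.zpowers_le]
          exact Subgroup.subset_closure (by simp)
        rw [← Subgroup.comap_map_eq_self hle, Subgroup.eq_top_of_lt_of_index_eq_prime hp hHi
          (K := (Subgroup.closure {a, z, g}).map f) (g := f g) ?_ ?_ hq', Subgroup.comap_top]
        · rw [Subgroup.zpowers_le]
          exact Subgroup.mem_map_of_mem f (Subgroup.subset_closure (by simp))
        · exact Subgroup.mem_map_of_mem f (Subgroup.subset_closure (by simp))
      refine augmentationVanishes_of_quotient_relations hn2 (fun x => ?_) hgen hzp hcomm
        (k := k) (r := r) (l := l) (s := s) ?_ ?_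
      · obtain ⟨j, hj⟩ := IsPGroup.iff_orderOf.mp hG x
        have := hord x
        rw [hj, Nat.pow_lt_pow_iff_right hp.one_lt] at this
        rw [← orderOf_dvd_iff_pow_eq_one, hj]
        exact pow_dvd_pow p (by omega)
      · rw [hl, ← mul_assoc, ((hcomm _).pow_left l).eq]
      · rw [hs, ((hcomm _).pow_left s).eq]
    · have := h.of_quotient hfs hker hcomm hzp
      rwa [← pow_succ', Nat.sub_add_cancel (by omega)] at this

/-! ### Sharp bounds given a cyclic subgroup of index p -/

section CyclicMaximal

variable {p : ℕ} {G : Type*} [Group G] [Finite G]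

/-- The relations involve only `a` and `g`, so `z = 1` and `M = 0` remove the `c`-term from the
general bound. -/
theorem augmentationVanishes_of_cyclic_index_eq_prime (hp : p.Prime) (hG : IsPGroup p G)
    (hnc : ¬ IsCyclic G) {a g : G} (ha : (Subgroup.zpowers a).index = p)
    (hg : g ∉ Subgroup.zpowers a) : AugmentationVanishes p G (orderOf a + p - 1) := by
  have := Fact.mk hp
  obtain ⟨k, r, hk, hr⟩ := exists_relations_of_index_zpowers_eq hp hG hnc ha hg
  obtain ⟨N, hN⟩ := IsPGroup.iff_orderOf.mp hG a
  have hgen : Subgroup.closure {a, 1, g} = ⊤ := by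
    refine Subgroup.eq_top_of_lt_of_index_eq_prime hp ha ?_ (Subgroup.subset_closure (by simp)) hg
    rw [Subgroup.zpowers_le]
    exact Subgroup.subset_closure (by simp)
  have := augmentationVanishes_of_generators (p := p) (z := 1) (k := k) (r := r) (l := 0) (s := 0)
    (c := 1) (N := N) (M := 0) hgen (Commute.one_right a) (Commute.one_right g) (by simpa using hk)
    (by simpa using hr) le_rfl (by simp) (by simp) (by rw [← hN, pow_orderOf_eq_one]) (by simp)
  simpa [hN] using this

/-- Modulo ⟨a⟩, a product equal to 1 uses a multiple of `p` copies of `g`, hence none; what remains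
is a power of `a` with exponent positive and below its order. -/
theorem one_notMem_seqSubproducts_replicate (hp : p.Prime) {a g : G} [(Subgroup.zpowers a).Normal]
    (ha : (Subgroup.zpowers a).index = p) (hg : g ∉ Subgroup.zpowers a) :
    (1 : G) ∉ seqSubproducts
      (Multiset.replicate (orderOf a - 1) a + Multiset.replicate (p - 1) g) := by
  classical
  rintro ⟨T, hT, hT1, l, rfl, hl⟩
  have hag : a ≠ g := fun h => hg (h ▸ Subgroup.mem_zpowers a)
  have hmem : ∀ x ∈ l, x = a ∨ x = g := by
    intro x hx
    have := Multiset.mem_of_le hT (Multiset.mem_coe.mpr hx)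
    rw [Multiset.mem_add] at this
    exact this.imp Multiset.eq_of_mem_replicate Multiset.eq_of_mem_replicate
  have hca : l.count a ≤ orderOf a - 1 := by
    have := Multiset.count_le_of_le a hT
    simpa [Multiset.count_replicate, hag.symm] using this
  have hcg : l.count g ≤ p - 1 := by
    have := Multiset.count_le_of_le g hT
    simpa [Multiset.count_replicate, hag] using this
  set f := QuotientGroup.mk' (Subgroup.zpowers a) with hf
  have hprod : f l.prod = f g ^ l.count g := by
    clear hT hT1 hl hca hcg
    induction l with
    | nil => simp
    | cons x l ih =>
      rw [List.prod_cons, map_mul, ih fun y hy => hmem y (List.mem_cons_of_mem x hy)]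
      rcases hmem x List.mem_cons_self with rfl | rfl
      · have : f x = 1 := by
          rw [← MonoidHom.mem_ker, QuotientGroup.ker_mk']
          exact Subgroup.mem_zpowers x
        rw [this, one_mul, List.count_cons_of_ne hag]
      · rw [List.count_cons_self, pow_succ']
  have horder : orderOf (f g) = p := by
    have : orderOf (f g) ∣ p := by
      rw [← ha]
      exact orderOf_dvd_natCard (f g)
    refine ((Nat.dvd_prime hp).mp this).resolve_left fun h => hg ?_
    rwa [orderOf_eq_one_iff, ← MonoidHom.mem_ker, QuotientGroup.ker_mk'] at h
  have hg0 : l.count g = 0 := by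
    rw [hl, map_one] at hprod
    have h := orderOf_dvd_of_pow_eq_one hprod.symm
    rw [horder] at h
    exact Nat.eq_zero_of_dvd_of_lt h (by have := hp.pos; omega)
  have hrep : l = List.replicate l.length a := List.eq_replicate_iff.mpr
    ⟨rfl, fun x hx => (hmem x hx).resolve_right fun h => List.count_eq_zero.mp hg0 (h ▸ hx)⟩
  have hlen : l.count a = l.length := by
    rw [hrep, List.count_replicate_self, List.length_replicate]
  rw [hrep, List.prod_replicate] at hl
  have : orderOf a ≤ l.length :=
    Nat.le_of_dvd (Nat.lt_of_lt_of_le Nat.zero_lt_one hT1) (orderOf_dvd_of_pow_eq_one hl)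
  have := orderOf_pos a
  omega

end CyclicMaximal

/-! ### The equivalence -/

theorem theorem1p7 (p : ℕ) (hp : p.Prime) (G : Type*) [Group G] [Finite G]
    (hG : IsPGroup p G) (hnc : ¬ IsCyclic G) :
    (∃ H : Subgroup G, IsCyclic H ∧ H.index = p) ↔
      (smallDavenport G + 1 = orderedDavenport G ∧
        orderedDavenport G = loewyLength p G ∧
        loewyLength p G = Nat.card G / p + p - 1) := by
  have := Fact.mk hp
  constructor
  · rintro ⟨H, hH, hHi⟩
    obtain ⟨a, rfl⟩ := (Subgroup.isCyclic_iff_exists_zpowers_eq_top H).mp hH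
    obtain ⟨g, hg⟩ : ∃ g, g ∉ Subgroup.zpowers a := by
      by_contra! h
      rw [(Subgroup.eq_top_iff' _).mpr h, Subgroup.index_top] at hHi
      exact hp.one_lt.ne hHi
    have : (Subgroup.zpowers a).Normal := Subgroup.normal_of_index_eq_prime_of_isPGroup hp hG hHi
    have hcard : Nat.card G / p = orderOf a := by
      rw [← Subgroup.card_mul_index (Subgroup.zpowers a), hHi, Nat.card_zpowers,
        Nat.mul_div_cancel _ hp.pos]
    have hvan := augmentationVanishes_of_cyclic_index_eq_prime hp hG hnc hHi hg
    have h1 := loewyLength_le hvan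
    have h2 := orderedDavenport_le (augmentationVanishes_loewyLength hvan)
    have h3 := smallDavenport_lt_orderedDavenport (G := G)
    have h4 := le_smallDavenport (one_notMem_seqSubproducts_replicate hp hHi hg)
    rw [Multiset.card_add, Multiset.card_replicate, Multiset.card_replicate] at h4
    have h5 := orderOf_pos a
    have h6 := hp.two_le
    -- The chain `|a| + p - 2 ≤ d < D_o ≤ L ≤ |a| + p - 1` leaves no slack.
    rw [hcard]
    omega
  · rintro ⟨-, -, hL⟩
    obtain ⟨n, hn⟩ := IsPGroup.iff_card.mp hG
    have hn0 : n ≠ 0 := by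
      rintro rfl
      have := (Nat.card_eq_one_iff_unique.mp (by simpa using hn)).1
      exact hnc inferInstance
    rcases isCyclic_or_exists_or_augmentationVanishes hp n G hn with h | h | h
    · exact absurd h hnc
    · exact h
    -- `L ≤ p ^ (n - 1)` contradicts `L = p ^ (n - 1) + p - 1`, because `p ≥ 2`.
    · have h1 := loewyLength_le h
      have h2 : Nat.card G / p = p ^ (n - 1) := by
        rw [hn, ← Nat.pow_div (by omega) hp.pos, pow_one]
      have h3 := hp.two_le
      omega
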